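/- Let $\mathbb{M}=(M_p)_{p\ge 0}$ be a sequence of positive real numbers with $M_0=1$, let $m_p:=M_{p+1}/M_p$, and suppose that $\mathbb{M}$ is logarithmically convex (lc), i.e. $M_p^2\le M_{p-1}M_{p+1}$ for all $p\ge1$, and that $\lim_{p\to\infty}m_p=\infty$. For $t>0$ put $M(t):=\sup_{p\ge0}\log(t^p/M_p)$ and, for $t$ large, $d_{\mathbb{M}}(t):=\log(M(t))/\log(t)$. Assume that at least one of the following conditions holds. (a) $d_{\mathbb{M}}$ is a nonzero proximate order. That is, for some $c$, on $(c,\infty)$ the function $d_{\mathbb{M}}$ is nonnegative, continuous, and differentiable except possibly at points of which every bounded interval contains only finitely many and at which the two one-sided derivatives exist, are finite and are distinct; $\lim_{t\to\infty}d_{\mathbb{M}}(t)$ exists in $(0,\infty)$; and $t\,d_{\mathbb{M}}'(t)\log(t)\to0$ as $t\to\infty$ through the points of differentiability. (b) $\lim_{p\to\infty}\log\big(m_p/M_p^{1/p}\big)$ exists in $(0,\infty)$. (c) $(m_p)$ is regularly varying with positive index: there is $w>0$ such that $\lim_{p\to\infty}m_{\lfloor\lambda p\rfloor}/m_p=\lambda^{w}$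 for every real $\lambda>0$. (d) There is $w>0$ such that $\lim_{p\to\infty}m_{\ell p}/m_p=\ell^{w}$ for every natural number $\ell\ge2$. Then $\mathbb{M}$ is strongly regular, that is, besides (lc) it satisfies: there is $A>0$ with $M_{p+q}\le A^{p+q}M_pM_q$ for all $p,q\ge0$, and there is $B>0$ with $\sum_{q\ge p}\frac{M_q}{(q+1)M_{q+1}}\le B\,\frac{M_p}{M_{p+1}}$ for all $p\ge0$. Moreover, let $$\omega(\mathbb{M}):=\liminf_{p\to\infty}\frac{\log(m_p)}{\log(p)}\in[0,\infty],$$ and let $\gamma(\mathbb{M})$ be the supremum of all $\gamma>0$ for which there are real numbers $m'_p$ and constants $C,D>0$ with $D\,m_p\le m'_p\le C\,m_p$ for all $p\ge0$ and with $\big((p+1)^{-\gamma}m'_p\big)_{p\ge0}$ nondecreasing. Then $\gamma(\mathbb{M})\in(0,\infty)$, $$\gamma(\mathbb{M})=\omega(\mathbb{M})\qquad\text{and}\qquad\lim_{p\to\infty}\frac{\log(m_p)}{\log(p)}=\omega(\mathbb{M}).$$ -/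

import Mathlib

open Filter Topology

namespace WeightSeq

/-- The sequence of quotients `m p = M (p+1) / M p`. -/
noncomputable def quot (M : ℕ → ℝ) (p : ℕ) : ℝ := M (p + 1) / M p

/-- (lc): `M p ^ 2 ≤ M (p-1) * M (p+1)` for all `p ≥ 1`. -/
def LogConvex (M : ℕ → ℝ) : Prop :=
  ∀ p : ℕ, 1 ≤ p → M p ^ 2 ≤ M (p - 1) * M (p + 1)

/-- (mg): moderate growth. -/
def ModerateGrowth (M : ℕ → ℝ) : Prop :=
  ∃ A : ℝ, 0 < A ∧ ∀ p q : ℕ, M (p + q) ≤ A ^ (p + q) * M p * M q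

/-- (snq): strong non-quasianalyticity; the series over `q ≥ p` is indexed by `q = p + j`. -/
def StrongNonQuasianalytic (M : ℕ → ℝ) : Prop :=
  ∃ B : ℝ, 0 < B ∧ ∀ p : ℕ,
    Summable (fun j : ℕ => M (p + j) / (((p + j : ℕ) + 1 : ℝ) * M (p + j + 1))) ∧
    ∑' j : ℕ, M (p + j) / (((p + j : ℕ) + 1 : ℝ) * M (p + j + 1)) ≤ B * (M p / M (p + 1))

/-- Strongly regular sequences. -/
structure StronglyRegular (M : ℕ → ℝ) : Prop where
  logConvex : LogConvex M
  moderateGrowth : ModerateGrowth M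
  strongNonQuasianalytic : StrongNonQuasianalytic M

/-- Equivalence `m ≃ l` of sequences. -/
def QuotEquiv (m l : ℕ → ℝ) : Prop :=
  ∃ c d : ℝ, 0 < c ∧ 0 < d ∧ ∀ p : ℕ, d * l p ≤ m p ∧ m p ≤ c * l p

/-- Property `(P_γ)`: some `m' ≃ m` is such that `(p+1)^(-γ) * m' p` is nondecreasing. -/
def PropertyP (M : ℕ → ℝ) (γ : ℝ) : Prop :=
  ∃ m' : ℕ → ℝ, QuotEquiv m' (quot M) ∧
    Monotone (fun p : ℕ => ((p : ℝ) + 1) ^ (-γ) * m' p)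

/-- The growth index `γ(M)`, a supremum taken in the extended reals. -/
noncomputable def growthIndex (M : ℕ → ℝ) : EReal :=
  sSup {x : EReal | ∃ γ : ℝ, 0 < γ ∧ PropertyP M γ ∧ x = (γ : EReal)}

/-- The index `ω(M) = liminf log (m p) / log p`, taken in the extended reals. -/
noncomputable def omegaIndex (M : ℕ → ℝ) : EReal :=
  liminf (fun p : ℕ => ((Real.log (quot M p) / Real.log p : ℝ) : EReal)) atTop

/-- The associated function `M(t) = sup_p log (t ^ p / M p)` for `t > 0`, and `M(0) = 0`.
The supremum is finite when `M` is log-convex with quotients tending to infinity. -/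
noncomputable def assocFun (M : ℕ → ℝ) (t : ℝ) : ℝ :=
  if 0 < t then ⨆ p : ℕ, Real.log (t ^ p / M p) else 0

/-- `d_M(t) = log M(t) / log t`, meaningful for large `t`. -/
noncomputable def dFun (M : ℕ → ℝ) (t : ℝ) : ℝ :=
  Real.log (assocFun M t) / Real.log t

/-- `ρ`, considered on `(c, ∞)`, is a proximate order with limit `l`: it is continuous;
nondifferentiable only at points of which every bounded interval contains finitely many, and
there with distinct finite lateral derivatives; nonnegative; tends to `l`; and
`r ρ'(r) log r → 0` as `r → ∞` through the points of differentiability. -/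
structure IsProximateOrder (c : ℝ) (ρ : ℝ → ℝ) (l : ℝ) : Prop where
  continuousOn : ContinuousOn ρ (Set.Ioi c)
  finite_nondiff : ∀ R : ℝ, {r : ℝ | c < r ∧ r ≤ R ∧ ¬ DifferentiableAt ℝ ρ r}.Finite
  lateral : ∀ r : ℝ, c < r → ¬ DifferentiableAt ℝ ρ r →
    ∃ a b : ℝ, a ≠ b ∧ HasDerivWithinAt ρ a (Set.Iio r) r ∧ HasDerivWithinAt ρ b (Set.Ioi r) r
  nonneg : ∀ r : ℝ, c < r → 0 ≤ ρ r
  tendsto : Tendsto ρ atTop (𝓝 l)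
  tendsto_deriv : Tendsto (fun r : ℝ => r * deriv ρ r * Real.log r)
    (atTop ⊓ 𝓟 {r : ℝ | DifferentiableAt ℝ ρ r}) (𝓝 0)

/-- Regularly varying sequences: `s ⌊λ p⌋ / s p` has a limit in `(0, ∞)` for each `λ > 0`. -/
def RegularlyVarying (s : ℕ → ℝ) : Prop :=
  ∀ lam : ℝ, 0 < lam → ∃ ψ : ℝ, 0 < ψ ∧
    Tendsto (fun p : ℕ => s ⌊lam * (p : ℝ)⌋₊ / s p) atTop (𝓝 ψ)

/-- `w` is the index of regular variation of `s`: the limit function is `λ ↦ λ ^ w`. -/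
def IsIndexOfRegularVariation (s : ℕ → ℝ) (w : ℝ) : Prop :=
  ∀ lam : ℝ, 0 < lam →
    Tendsto (fun p : ℕ => s ⌊lam * (p : ℝ)⌋₊ / s p) atTop (𝓝 (lam ^ w))

/-- (a): `d_M` is, for large arguments, a nonzero proximate order. -/
def CondA (M : ℕ → ℝ) : Prop :=
  ∃ c l : ℝ, 0 < l ∧ IsProximateOrder c (dFun M) l

/-- (b): `log (m p / M p ^ (1/p))` has a limit in `(0, ∞)`. -/
def CondB (M : ℕ → ℝ) : Prop :=
  ∃ l : ℝ, 0 < l ∧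
    Tendsto (fun p : ℕ => Real.log (quot M p / M p ^ (1 / (p : ℝ)))) atTop (𝓝 l)

/-- (c): the quotients are regularly varying with a positive index. -/
def CondC (M : ℕ → ℝ) : Prop :=
  RegularlyVarying (quot M) ∧ ∃ w : ℝ, 0 < w ∧ IsIndexOfRegularVariation (quot M) w

/-- (d): for some `w > 0`, `m (l p) / m p → l ^ w` for every natural `l ≥ 2`. -/
def CondD (M : ℕ → ℝ) : Prop :=
  ∃ w : ℝ, 0 < w ∧ ∀ l : ℕ, 2 ≤ l →
    Tendsto (fun p : ℕ => quot M (l * p) / quot M p) atTop (𝓝 ((l : ℝ) ^ w))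

end WeightSeq

/-! Each of the four conditions forces `m (2p) / m p → 2 ^ w` for some `w > 0`, and this with the
monotonicity of `m` gives everything (`conclusion_of_doubling`).

Iterated over dyadic blocks, it shows for `0 < γ < w < δ` that `(p+1)^(-γ) * m p` is increasing up
to a constant factor and that `m p = O(p^δ)`. The first yields `(P_γ)`, and (snq) by comparison with
a telescoping series; the upper doubling bound yields (mg). Together they give `log (m p) / log p →
w`. As `(P_γ)` forces `m p ≥ C p^γ`, no `γ > w` is admissible, so both indices equal `w`.

Under (c) or (d) doubling is immediate. Under (b), `log (m p)` exceeds the mean `(1/p) log (M p)` of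
its predecessors by `w + o(1)`, so the means, and hence `log m`, gain `w log 2 + o(1)` from `p` to
`2p`. Under (a), between distinct consecutive quotients `M(t) = n log t - log M_n`, so `t d' log t +
d = n / M(t)`, which tends to `l`; read at `t = m p`, this is (b) with limit `1/l`. -/

namespace WeightSeq

section Basic

variable {M : ℕ → ℝ}

lemma quot_pos (hpos : ∀ p, 0 < M p) (p : ℕ) : 0 < quot M p :=
  div_pos (hpos _) (hpos _)

lemma quot_monotone (hpos : ∀ p, 0 < M p) (hlc : LogConvex M) : Monotone (quot M) := by
  refine monotone_nat_of_le_succ fun p => ?_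
  have h := hlc (p + 1) (by omega)
  simp only [Nat.add_sub_cancel] at h
  unfold quot
  rw [div_le_div_iff₀ (hpos _) (hpos _)]
  nlinarith

lemma mul_quot (hpos : ∀ p, 0 < M p) (p : ℕ) : M (p + 1) = M p * quot M p := by
  unfold quot
  field_simp [(hpos p).ne']

end Basic

/-! ### Power bounds from dyadic doubling -/

section Doubling

variable {m : ℕ → ℝ}

lemma exists_pow_two_mul_bounds {p q : ℕ} (hp : 1 ≤ p) (hpq : p ≤ q) :
    ∃ k : ℕ, 2 ^ k * p ≤ q ∧ q + 1 ≤ 2 ^ (k + 1) * p := by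
  refine ⟨Nat.log 2 (q / p), ?_, ?_⟩
  · have h : 2 ^ Nat.log 2 (q / p) ≤ q / p :=
      Nat.pow_log_le_self 2 (Nat.div_pos hpq hp).ne'
    exact (Nat.le_div_iff_mul_le hp).1 h
  · have h : q / p < 2 ^ (Nat.log 2 (q / p) + 1) :=
      Nat.lt_pow_succ_log_self (by norm_num) _
    exact (Nat.div_lt_iff_lt_mul hp).1 h

lemma le_apply_pow_two_mul {a : ℝ} (ha : 0 < a) {N : ℕ}
    (h : ∀ p, N ≤ p → a * m p ≤ m (2 * p)) {p : ℕ} (hp : N ≤ p) (k : ℕ) :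
    a ^ k * m p ≤ m (2 ^ k * p) := by
  induction k with
  | zero => simp
  | succ k ih =>
    have h1 := h (2 ^ k * p) (hp.trans (Nat.le_mul_of_pos_left _ (by positivity)))
    calc a ^ (k + 1) * m p = a * (a ^ k * m p) := by ring
      _ ≤ a * m (2 ^ k * p) := by gcongr
      _ ≤ m (2 * (2 ^ k * p)) := h1
      _ = m (2 ^ (k + 1) * p) := by congr 1; ring

lemma apply_pow_two_mul_le {a : ℝ} (ha : 0 < a) {N : ℕ}
    (h : ∀ p, N ≤ p → m (2 * p) ≤ a * m p) {p : ℕ} (hp : N ≤ p) (k : ℕ) :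
    m (2 ^ k * p) ≤ a ^ k * m p := by
  have := le_apply_pow_two_mul (m := fun n => -m n) ha (N := N)
    (fun p hp => by linarith [h p hp]) hp k
  linarith

/-- If `m` eventually grows at least by `2 ^ γ` under doubling, then `(p + 1) ^ (-γ) * m p` is
almost increasing. -/
lemma almost_increasing_of_doubling (hmpos : ∀ p, 0 < m p) (hmono : Monotone m) {γ : ℝ}
    (hγ : 0 < γ) (h : ∀ᶠ p in atTop, (2 : ℝ) ^ γ * m p ≤ m (2 * p)) :
    ∃ K : ℝ, 0 < K ∧ ∀ p q : ℕ, p ≤ q →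
      ((p : ℝ) + 1) ^ (-γ) * m p ≤ K * (((q : ℝ) + 1) ^ (-γ) * m q) := by
  obtain ⟨N₀, hN₀⟩ := eventually_atTop.1 h
  set N := max N₀ 1 with hN
  have h2 : (0 : ℝ) < 2 ^ γ := by positivity
  have h2' : (1 : ℝ) ≤ 2 ^ γ := Real.one_le_rpow (by norm_num) hγ.le
  have hN1 : (1 : ℝ) ≤ ((N : ℝ) + 1) ^ γ :=
    Real.one_le_rpow (by have : (0 : ℝ) ≤ N := by positivity
                         linarith) hγ.le
  have fpos : ∀ p : ℕ, 0 < ((p : ℝ) + 1) ^ (-γ) * m p := fun p =>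
    mul_pos (by positivity) (hmpos p)
  -- With `q` in the `k`-th dyadic block above `p`, `m` gains `2^(γk)` while the weight loses at
  -- most `2^(γ(k+1))`.
  have large : ∀ p q : ℕ, N ≤ p → p ≤ q →
      ((p : ℝ) + 1) ^ (-γ) * m p ≤ 2 ^ γ * (((q : ℝ) + 1) ^ (-γ) * m q) := by
    intro p q hp hpq
    obtain ⟨k, hk1, hk2⟩ := exists_pow_two_mul_bounds ((le_max_right _ _).trans hp) hpq
    have h3 : ((2 : ℝ) ^ γ) ^ k * m p ≤ m q :=
      (le_apply_pow_two_mul h2 hN₀ ((le_max_left _ _).trans hp) k).trans (hmono hk1)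
    have h4 : ((q : ℝ) + 1) ≤ 2 ^ (k + 1) * ((p : ℝ) + 1) := by
      have : ((q + 1 : ℕ) : ℝ) ≤ ((2 ^ (k + 1) * p : ℕ) : ℝ) := by exact_mod_cast hk2
      push_cast at this
      have h5 : (0 : ℝ) < 2 ^ (k + 1) := by positivity
      linarith
    have h5 : ((q : ℝ) + 1) ^ γ ≤ 2 ^ γ * ((2 : ℝ) ^ γ) ^ k * ((p : ℝ) + 1) ^ γ := by
      calc ((q : ℝ) + 1) ^ γ ≤ (2 ^ (k + 1) * ((p : ℝ) + 1)) ^ γ :=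
            Real.rpow_le_rpow (by positivity) h4 hγ.le
        _ = ((2 : ℝ) ^ (k + 1)) ^ γ * ((p : ℝ) + 1) ^ γ :=
            Real.mul_rpow (by positivity) (by positivity)
        _ = _ := by
            rw [← Real.rpow_natCast, ← Real.rpow_mul (by norm_num), mul_comm _ γ,
              Real.rpow_mul (by norm_num), Real.rpow_natCast, pow_succ]
            ring
    rw [Real.rpow_neg (by positivity), Real.rpow_neg (by positivity), inv_mul_eq_div,
      inv_mul_eq_div, ← mul_div_assoc, div_le_div_iff₀ (by positivity) (by positivity)]
    calc m p * ((q : ℝ) + 1) ^ γ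
        ≤ m p * (2 ^ γ * ((2 : ℝ) ^ γ) ^ k * ((p : ℝ) + 1) ^ γ) :=
          mul_le_mul_of_nonneg_left h5 (hmpos p).le
      _ = 2 ^ γ * (((2 : ℝ) ^ γ) ^ k * m p) * ((p : ℝ) + 1) ^ γ := by ring
      _ ≤ 2 ^ γ * m q * ((p : ℝ) + 1) ^ γ := by gcongr
  -- Below `N` all weights lie between `(N+1)^(-γ)` and `1`, so monotonicity of `m` suffices.
  have small : ∀ p q : ℕ, p ≤ q → q ≤ N →
      ((p : ℝ) + 1) ^ (-γ) * m p ≤ ((N : ℝ) + 1) ^ γ * (((q : ℝ) + 1) ^ (-γ) * m q) := by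
    intro p q hpq hq
    have h1 : ((p : ℝ) + 1) ^ (-γ) ≤ 1 :=
      Real.rpow_le_one_of_one_le_of_nonpos
        (by have : (0 : ℝ) ≤ p := by positivity
            linarith) (by linarith)
    have h3 : 1 ≤ ((N : ℝ) + 1) ^ γ * ((q : ℝ) + 1) ^ (-γ) := by
      rw [Real.rpow_neg (by positivity), ← div_eq_mul_inv, one_le_div (by positivity)]
      exact Real.rpow_le_rpow (by positivity) (by gcongr) hγ.le
    calc ((p : ℝ) + 1) ^ (-γ) * m p ≤ 1 * m q :=
          mul_le_mul h1 (hmono hpq) (hmpos p).le zero_le_one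
      _ ≤ (((N : ℝ) + 1) ^ γ * ((q : ℝ) + 1) ^ (-γ)) * m q :=
          mul_le_mul_of_nonneg_right h3 (hmpos q).le
      _ = _ := by ring
  -- A pair straddling `N` is compared through `N`, whence the product.
  refine ⟨((N : ℝ) + 1) ^ γ * 2 ^ γ, by positivity, fun p q hpq => ?_⟩
  rcases le_total q N with hq | hq
  · refine (small p q hpq hq).trans ?_
    exact mul_le_mul_of_nonneg_right (le_mul_of_one_le_right (by positivity) h2') (fpos q).le
  · rcases le_total p N with hp | hp
    · refine (small p N hp le_rfl).trans ?_
      rw [mul_assoc]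
      exact mul_le_mul_of_nonneg_left (large N q le_rfl hq) (by positivity)
    · refine (large p q hp hpq).trans ?_
      exact mul_le_mul_of_nonneg_right (le_mul_of_one_le_left (by positivity) hN1) (fpos q).le

lemma exists_le_mul_rpow_of_doubling (hmpos : ∀ p, 0 < m p) (hmono : Monotone m) {δ : ℝ}
    (hδ : 0 < δ) (h : ∀ᶠ p in atTop, m (2 * p) ≤ (2 : ℝ) ^ δ * m p) :
    ∃ C : ℝ, 0 < C ∧ ∀ᶠ q : ℕ in atTop, m q ≤ C * (q : ℝ) ^ δ := by
  obtain ⟨N₀, hN₀⟩ := eventually_atTop.1 h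
  set N := max N₀ 1 with hN
  have h2 : (0 : ℝ) < 2 ^ δ := by positivity
  refine ⟨2 ^ δ * m N, mul_pos h2 (hmpos N), eventually_atTop.2 ⟨N, fun q hq => ?_⟩⟩
  obtain ⟨k, hk1, hk2⟩ := exists_pow_two_mul_bounds (le_max_right N₀ 1) hq
  have h4 : ((2 : ℝ) ^ k) ≤ q := by
    have : 2 ^ k ≤ q := (Nat.le_mul_of_pos_right _ (le_max_right N₀ 1)).trans hk1
    exact_mod_cast this
  have h5 : ((2 : ℝ) ^ δ) ^ k ≤ (q : ℝ) ^ δ := by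
    rw [← Real.rpow_natCast, ← Real.rpow_mul (by norm_num), mul_comm δ,
      Real.rpow_mul (by norm_num), Real.rpow_natCast]
    exact Real.rpow_le_rpow (by positivity) h4 hδ.le
  calc m q ≤ m (2 ^ (k + 1) * N) := hmono ((Nat.le_succ q).trans hk2)
    _ ≤ ((2 : ℝ) ^ δ) ^ (k + 1) * m N := apply_pow_two_mul_le h2 hN₀ (le_max_left _ _) _
    _ = 2 ^ δ * m N * ((2 : ℝ) ^ δ) ^ k := by ring
    _ ≤ 2 ^ δ * m N * (q : ℝ) ^ δ :=
      mul_le_mul_of_nonneg_left h5 (mul_pos h2 (hmpos N)).le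

lemma tendsto_log_natCast : Tendsto (fun p : ℕ => Real.log p) atTop atTop :=
  Real.tendsto_log_atTop.comp tendsto_natCast_atTop_atTop

lemma tendsto_log_mul_rpow_div_log {C : ℝ} (hC : 0 < C) (γ : ℝ) :
    Tendsto (fun p : ℕ => Real.log (C * (p : ℝ) ^ γ) / Real.log p) atTop (𝓝 γ) := by
  have h1 : Tendsto (fun p : ℕ => Real.log C / Real.log p + γ) atTop (𝓝 (0 + γ)) :=
    (tendsto_log_natCast.const_div_atTop _).add_const _
  rw [zero_add] at h1
  refine h1.congr' ?_
  filter_upwards [tendsto_log_natCast.eventually_gt_atTop 0, eventually_gt_atTop 0] with p hp hp0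
  have hp0' : (0 : ℝ) < p := by exact_mod_cast hp0
  rw [Real.log_mul hC.ne' (by positivity), Real.log_rpow hp0', add_div,
    mul_div_cancel_right₀ _ hp.ne']

lemma eventually_lt_log_div_log {C γ a : ℝ} (hC : 0 < C) (ha : a < γ)
    (h : ∀ᶠ p : ℕ in atTop, C * (p : ℝ) ^ γ ≤ m p) :
    ∀ᶠ p : ℕ in atTop, a < Real.log (m p) / Real.log p := by
  filter_upwards [h, (tendsto_log_mul_rpow_div_log hC γ).eventually_const_lt ha,
    tendsto_log_natCast.eventually_gt_atTop 0, eventually_gt_atTop 0] with p h1 h2 h3 h4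
  have h4' : (0 : ℝ) < p := by exact_mod_cast h4
  refine h2.trans_le ?_
  exact div_le_div_of_nonneg_right (Real.log_le_log (by positivity) h1) h3.le

lemma eventually_log_div_log_lt (hmpos : ∀ p, 0 < m p) {C γ a : ℝ} (hC : 0 < C) (ha : γ < a)
    (h : ∀ᶠ p : ℕ in atTop, m p ≤ C * (p : ℝ) ^ γ) :
    ∀ᶠ p : ℕ in atTop, Real.log (m p) / Real.log p < a := by
  filter_upwards [h, (tendsto_log_mul_rpow_div_log hC γ).eventually_lt_const ha,
    tendsto_log_natCast.eventually_gt_atTop 0] with p h1 h2 h3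
  refine lt_of_le_of_lt ?_ h2
  exact div_le_div_of_nonneg_right (Real.log_le_log (hmpos p) h1) h3.le

/-- Lower power bound extracted from almost monotonicity of `(p + 1) ^ (-γ) * m p`. -/
lemma exists_mul_rpow_le_of_almost_increasing (hmpos : ∀ p, 0 < m p) {γ K : ℝ} (hγ : 0 < γ)
    (hK : 0 < K)
    (h : ∀ p q : ℕ, p ≤ q →
      ((p : ℝ) + 1) ^ (-γ) * m p ≤ K * (((q : ℝ) + 1) ^ (-γ) * m q)) :
    ∃ C : ℝ, 0 < C ∧ ∀ᶠ q : ℕ in atTop, C * (q : ℝ) ^ γ ≤ m q := by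
  refine ⟨m 0 / K, div_pos (hmpos 0) hK, Eventually.of_forall fun q => ?_⟩
  have h1 := h 0 q (Nat.zero_le _)
  simp only [Nat.cast_zero, zero_add, Real.one_rpow, one_mul] at h1
  rw [Real.rpow_neg (by positivity), inv_mul_eq_div, ← mul_div_assoc,
    le_div_iff₀ (by positivity)] at h1
  rw [div_mul_eq_mul_div, div_le_iff₀ hK]
  calc m 0 * (q : ℝ) ^ γ ≤ m 0 * ((q : ℝ) + 1) ^ γ :=
        mul_le_mul_of_nonneg_left
          (Real.rpow_le_rpow (by positivity) (by linarith) hγ.le) (hmpos 0).le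
    _ ≤ m q * K := by linarith

lemma eventually_doubling_ge (hmpos : ∀ p, 0 < m p) {w γ : ℝ} (hγ : γ < w)
    (h : Tendsto (fun p : ℕ => m (2 * p) / m p) atTop (𝓝 ((2 : ℝ) ^ w))) :
    ∀ᶠ p in atTop, (2 : ℝ) ^ γ * m p ≤ m (2 * p) := by
  filter_upwards [h.eventually_const_lt
    (Real.rpow_lt_rpow_of_exponent_lt (by norm_num : (1 : ℝ) < 2) hγ)] with p hp
  exact ((lt_div_iff₀ (hmpos p)).1 hp).le

lemma eventually_doubling_le (hmpos : ∀ p, 0 < m p) {w δ : ℝ} (hδ : w < δ)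
    (h : Tendsto (fun p : ℕ => m (2 * p) / m p) atTop (𝓝 ((2 : ℝ) ^ w))) :
    ∀ᶠ p in atTop, m (2 * p) ≤ (2 : ℝ) ^ δ * m p := by
  filter_upwards [h.eventually_lt_const
    (Real.rpow_lt_rpow_of_exponent_lt (by norm_num : (1 : ℝ) < 2) hδ)] with p hp
  exact ((div_lt_iff₀ (hmpos p)).1 hp).le

lemma tendsto_log_div_log_of_doubling (hmpos : ∀ p, 0 < m p) (hmono : Monotone m) {w : ℝ}
    (hw : 0 < w)
    (h : Tendsto (fun p : ℕ => m (2 * p) / m p) atTop (𝓝 ((2 : ℝ) ^ w))) :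
    Tendsto (fun p : ℕ => Real.log (m p) / Real.log p) atTop (𝓝 w) := by
  refine tendsto_order.2 ⟨fun a ha => ?_, fun a ha => ?_⟩
  · obtain ⟨γ, hγ1, hγ2⟩ := exists_between (max_lt ha hw)
    have hγ0 : 0 < γ := (le_max_right _ _).trans_lt hγ1
    obtain ⟨K, hK, hK'⟩ := almost_increasing_of_doubling hmpos hmono hγ0
      (eventually_doubling_ge hmpos hγ2 h)
    obtain ⟨C, hC, hC'⟩ := exists_mul_rpow_le_of_almost_increasing hmpos hγ0 hK hK'
    exact eventually_lt_log_div_log hC ((le_max_left _ _).trans_lt hγ1) hC'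
  · obtain ⟨δ, hδ1, hδ2⟩ := exists_between ha
    obtain ⟨C, hC, hC'⟩ := exists_le_mul_rpow_of_doubling hmpos hmono (hw.trans hδ1)
      (eventually_doubling_le hmpos hδ1 h)
    exact eventually_log_div_log_lt hmpos hC hδ2 hC'

end Doubling

/-! ### Strong regularity and the two indices -/

section Regularity

variable {M : ℕ → ℝ}

/-- The running maximum of the weighted sequence is nondecreasing and, by almost monotonicity, at
most `K` times the sequence; removing the weight gives `m'`. -/
lemma propertyP_of_almost_increasing {γ K : ℝ} (hK : 0 < K)
    (h : ∀ p q : ℕ, p ≤ q →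
      ((p : ℝ) + 1) ^ (-γ) * quot M p ≤ K * (((q : ℝ) + 1) ^ (-γ) * quot M q)) :
    PropertyP M γ := by
  set f : ℕ → ℝ := fun p => ((p : ℝ) + 1) ^ (-γ) * quot M p with hf
  have inv : ∀ (p : ℕ) (x : ℝ), ((p : ℝ) + 1) ^ (-γ) * (((p : ℝ) + 1) ^ γ * x) = x := by
    intro p x
    rw [← mul_assoc, ← Real.rpow_add (by positivity), neg_add_cancel, Real.rpow_zero, one_mul]
  have inv' : ∀ (p : ℕ) (x : ℝ), ((p : ℝ) + 1) ^ γ * (((p : ℝ) + 1) ^ (-γ) * x) = x := by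
    intro p x
    rw [← mul_assoc, ← Real.rpow_add (by positivity), add_neg_cancel, Real.rpow_zero, one_mul]
  refine ⟨fun p => ((p : ℝ) + 1) ^ γ * partialSups f p, ⟨K, 1, hK, one_pos, fun p => ?_⟩, ?_⟩
  · have h1 : f p ≤ partialSups f p := le_partialSups f p
    have h2 : partialSups f p ≤ K * f p := partialSups_le f p _ fun i hi => h i p hi
    constructor
    · calc 1 * quot M p = ((p : ℝ) + 1) ^ γ * f p := by rw [hf, inv', one_mul]
        _ ≤ ((p : ℝ) + 1) ^ γ * partialSups f p :=
            mul_le_mul_of_nonneg_left h1 (by positivity)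
    · calc ((p : ℝ) + 1) ^ γ * partialSups f p ≤ ((p : ℝ) + 1) ^ γ * (K * f p) := by gcongr
        _ = K * (((p : ℝ) + 1) ^ γ * f p) := by ring
        _ = K * quot M p := by rw [hf, inv']
  · simp only [inv]
    exact (partialSups f).monotone

lemma PropertyP.almost_increasing {γ : ℝ} (h : PropertyP M γ) :
    ∃ K : ℝ, 0 < K ∧ ∀ p q : ℕ, p ≤ q →
      ((p : ℝ) + 1) ^ (-γ) * quot M p ≤ K * (((q : ℝ) + 1) ^ (-γ) * quot M q) := by
  obtain ⟨m', ⟨c, d, hc, hd, hcd⟩, hmono⟩ := h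
  refine ⟨c / d, div_pos hc hd, fun p q hpq => ?_⟩
  have h1 : ((p : ℝ) + 1) ^ (-γ) * m' p ≤ ((q : ℝ) + 1) ^ (-γ) * m' q := hmono hpq
  have h2 : ((p : ℝ) + 1) ^ (-γ) * (d * quot M p) ≤ ((p : ℝ) + 1) ^ (-γ) * m' p :=
    mul_le_mul_of_nonneg_left (hcd p).1 (by positivity)
  have h3 : ((q : ℝ) + 1) ^ (-γ) * m' q ≤ ((q : ℝ) + 1) ^ (-γ) * (c * quot M q) :=
    mul_le_mul_of_nonneg_left (hcd q).2 (by positivity)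
  rw [div_mul_eq_mul_div, le_div_iff₀ hd]
  linarith

/-- Induction on `p + q`, lowering the larger index. Restoring it multiplies the left side by `m
(p+q)`, where `p + q ≤ 2p + 1`, and the right side by `A * m p`. -/
lemma moderateGrowth_of_quot_le (hpos : ∀ p, 0 < M p) (hM0 : M 0 = 1)
    (hmono : Monotone (quot M)) {A : ℝ} (hA : 0 < A)
    (h : ∀ p, quot M (2 * p + 1) ≤ A * quot M p) : ModerateGrowth M := by
  have step : ∀ p q : ℕ, q ≤ p + 1 → M (p + q) ≤ A ^ (p + q) * M p * M q →
      M (p + 1 + q) ≤ A ^ (p + 1 + q) * M (p + 1) * M q := by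
    intro p q hpq ih
    have h1 : quot M (p + q) ≤ A * quot M p := (hmono (by omega)).trans (h p)
    have e : p + 1 + q = p + q + 1 := by omega
    rw [e, mul_quot hpos (p + q), mul_quot hpos p]
    calc M (p + q) * quot M (p + q)
        ≤ (A ^ (p + q) * M p * M q) * (A * quot M p) :=
          mul_le_mul ih h1 (quot_pos hpos _).le
            (mul_pos (mul_pos (by positivity) (hpos p)) (hpos q)).le
      _ = _ := by ring
  refine ⟨A, hA, ?_⟩
  suffices H : ∀ n p q : ℕ, p + q = n → M (p + q) ≤ A ^ (p + q) * M p * M q from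
    fun p q => H _ p q rfl
  intro n
  induction n with
  | zero =>
    intro p q hpq
    obtain ⟨rfl, rfl⟩ : p = 0 ∧ q = 0 := by omega
    simp [hM0]
  | succ n ih =>
    intro p q hpq
    rcases le_total q p with hle | hle
    · obtain ⟨p, rfl⟩ : ∃ p', p = p' + 1 := ⟨p - 1, by omega⟩
      exact step p q hle (ih p q (by omega))
    · obtain ⟨q, rfl⟩ : ∃ q', q = q' + 1 := ⟨q - 1, by omega⟩
      have := step q p hle (ih q p (by omega))
      rw [add_comm p (q + 1)]
      linarith

lemma exists_quot_le_of_doubling (hpos : ∀ p, 0 < M p) (hmono : Monotone (quot M)) {B : ℝ}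
    (hB : 0 < B) (h : ∀ᶠ p in atTop, quot M (2 * p) ≤ B * quot M p) :
    ∃ A : ℝ, 0 < A ∧ ∀ p, quot M (2 * p + 1) ≤ A * quot M p := by
  obtain ⟨N₀, hN₀⟩ := eventually_atTop.1 h
  set N := max N₀ 1 with hN
  have hB2 : 0 < B ^ 2 := by positivity
  have hA1 : 0 < quot M (2 * N + 1) / quot M 0 :=
    div_pos (quot_pos hpos _) (quot_pos hpos _)
  refine ⟨max (B ^ 2) (quot M (2 * N + 1) / quot M 0), lt_max_of_lt_left hB2, fun p => ?_⟩
  rcases le_total N p with hp | hp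
  · have hp1 : 1 ≤ p := (le_max_right _ _).trans hp
    have hp2 : N₀ ≤ p := (le_max_left _ _).trans hp
    calc quot M (2 * p + 1) ≤ quot M (2 ^ 2 * p) := hmono (by omega)
      _ ≤ B ^ 2 * quot M p := apply_pow_two_mul_le hB hN₀ hp2 2
      _ ≤ _ := mul_le_mul_of_nonneg_right (le_max_left _ _) (quot_pos hpos p).le
  · calc quot M (2 * p + 1) ≤ quot M (2 * N + 1) := hmono (by omega)
      _ = quot M (2 * N + 1) / quot M 0 * quot M 0 :=
        (div_mul_cancel₀ _ (quot_pos hpos 0).ne').symm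
      _ ≤ quot M (2 * N + 1) / quot M 0 * quot M p :=
        mul_le_mul_of_nonneg_left (hmono (Nat.zero_le _)) hA1.le
      _ ≤ _ := mul_le_mul_of_nonneg_right (le_max_right _ _) (quot_pos hpos p).le

/-- Telescoping majorant for the terms of the series of `x ^ (-1 - γ)`. -/
lemma rpow_neg_div_le_sub {γ x : ℝ} (hγ : 0 < γ) (hx : 1 ≤ x) :
    x ^ (-γ) / x ≤ 2 ^ (γ + 1) / γ * (x ^ (-γ) - (x + 1) ^ (-γ)) := by
  have hx0 : 0 < x := by linarith
  -- Combines `log y ≤ y - 1` at `y = x/(x+1)` with `1 + u ≤ exp u`.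
  have h1 : 1 + γ / (x + 1) ≤ (x / (x + 1)) ^ (-γ) := by
    have hy : 0 < x / (x + 1) := by positivity
    rw [Real.rpow_def_of_pos hy]
    have h2 := Real.log_le_sub_one_of_pos hy
    have h3 := Real.add_one_le_exp (Real.log (x / (x + 1)) * -γ)
    have h4 : x / (x + 1) - 1 = -(1 / (x + 1)) := by field_simp; ring
    rw [h4] at h2
    have h5 : γ / (x + 1) = γ * (1 / (x + 1)) := by ring
    rw [h5]
    nlinarith
  have h2 : (1 + γ / (x + 1)) * (x + 1) ^ (-γ) ≤ x ^ (-γ) := by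
    rw [Real.div_rpow hx0.le (by positivity), le_div_iff₀ (by positivity)] at h1
    exact h1
  have h3 : x ^ (-γ) ≤ 2 ^ γ * (x + 1) ^ (-γ) := by
    rw [Real.rpow_neg hx0.le, Real.rpow_neg (by positivity), ← div_eq_mul_inv,
      inv_eq_one_div, div_le_div_iff₀ (by positivity) (by positivity), one_mul,
      ← Real.mul_rpow (by norm_num) hx0.le]
    exact Real.rpow_le_rpow (by positivity) (by linarith) hγ.le
  have h4 : γ / (x + 1) * (x + 1) ^ (-γ) ≤ x ^ (-γ) - (x + 1) ^ (-γ) := by linarith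
  have h5 : 1 / x ≤ 2 * (1 / (x + 1)) := by
    rw [← mul_div_assoc, div_le_div_iff₀ hx0 (by positivity)]
    linarith
  calc x ^ (-γ) / x = x ^ (-γ) * (1 / x) := by ring
    _ ≤ (2 ^ γ * (x + 1) ^ (-γ)) * (2 * (1 / (x + 1))) :=
        mul_le_mul h3 h5 (by positivity) (by positivity)
    _ = 2 ^ (γ + 1) / γ * (γ / (x + 1) * (x + 1) ^ (-γ)) := by
        rw [Real.rpow_add (by norm_num), Real.rpow_one]
        field_simp
    _ ≤ _ := mul_le_mul_of_nonneg_left h4 (by positivity)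

/-- Since `1 / m q ≤ K (p+1)^γ (q+1)^(-γ) / m p`, the series is dominated by a telescoping one
starting at `(p+1)^(-γ)`, which cancels `(p+1)^γ`. -/
lemma strongNonQuasianalytic_of_almost_increasing (hpos : ∀ p, 0 < M p) {γ K : ℝ} (hγ : 0 < γ)
    (hK : 0 < K)
    (h : ∀ p q : ℕ, p ≤ q →
      ((p : ℝ) + 1) ^ (-γ) * quot M p ≤ K * (((q : ℝ) + 1) ^ (-γ) * quot M q)) :
    StrongNonQuasianalytic M := by
  set L : ℝ := 2 ^ (γ + 1) / γ with hL
  have hLpos : 0 < L := by positivity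
  refine ⟨K * L, by positivity, fun p => ?_⟩
  have hmp := quot_pos hpos p
  set a : ℕ → ℝ := fun j => (((p + j : ℕ) : ℝ) + 1) ^ (-γ) with ha
  set c : ℝ := K * L * ((p : ℝ) + 1) ^ γ / quot M p with hc
  have hcpos : 0 < c := by positivity
  have term : ∀ j : ℕ, M (p + j) / (((p + j : ℕ) + 1 : ℝ) * M (p + j + 1))
      ≤ c * (a j - a (j + 1)) := by
    intro j
    have hq := quot_pos hpos (p + j)
    have h1 := h p (p + j) (by omega)
    set x : ℝ := ((p + j : ℕ) : ℝ) + 1 with hx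
    have hx1 : 1 ≤ x := by
      have : (0 : ℝ) ≤ ((p + j : ℕ) : ℝ) := by positivity
      linarith
    have hx0 : 0 < x := by linarith
    have h2 := rpow_neg_div_le_sub hγ hx1
    have ha1 : a (j + 1) = (x + 1) ^ (-γ) := by
      simp only [ha, hx]
      push_cast
      ring_nf
    have ha0 : a j = x ^ (-γ) := rfl
    rw [ha1, ha0]
    have h3 : 1 / quot M (p + j) ≤ K * ((p : ℝ) + 1) ^ γ / quot M p * x ^ (-γ) := by
      rw [Real.rpow_neg (by positivity : (0 : ℝ) ≤ (p : ℝ) + 1), inv_mul_eq_div,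
        div_le_iff₀ (by positivity)] at h1
      rw [div_mul_eq_mul_div, div_le_div_iff₀ hq hmp]
      linarith
    calc M (p + j) / (x * M (p + j + 1)) = 1 / quot M (p + j) * (1 / x) := by
          rw [mul_quot hpos (p + j)]
          have := (hpos (p + j)).ne'
          field_simp
      _ ≤ (K * ((p : ℝ) + 1) ^ γ / quot M p * x ^ (-γ)) * (1 / x) := by gcongr
      _ = (K * ((p : ℝ) + 1) ^ γ / quot M p) * (x ^ (-γ) / x) := by ring
      _ ≤ (K * ((p : ℝ) + 1) ^ γ / quot M p) * (L * (x ^ (-γ) - (x + 1) ^ (-γ))) := by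
          gcongr
      _ = c * (x ^ (-γ) - (x + 1) ^ (-γ)) := by rw [hc]; ring
  have nonneg : ∀ j : ℕ, 0 ≤ M (p + j) / (((p + j : ℕ) + 1 : ℝ) * M (p + j + 1)) := fun j =>
    div_nonneg (hpos _).le (mul_nonneg (by positivity) (hpos _).le)
  have partial_le : ∀ n : ℕ, ∑ j ∈ Finset.range n,
      M (p + j) / (((p + j : ℕ) + 1 : ℝ) * M (p + j + 1)) ≤ K * L * (M p / M (p + 1)) := by
    intro n
    have an : 0 ≤ a n := by positivity
    have a0 : ((p : ℝ) + 1) ^ γ * a 0 = 1 := by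
      simp only [ha, add_zero]
      rw [← Real.rpow_add (by positivity), add_neg_cancel, Real.rpow_zero]
    calc _ ≤ ∑ j ∈ Finset.range n, c * (a j - a (j + 1)) :=
          Finset.sum_le_sum fun j _ => term j
      _ = c * (a 0 - a n) := by rw [← Finset.mul_sum, Finset.sum_range_sub']
      _ ≤ c * a 0 := by gcongr; linarith
      _ = K * L / quot M p * (((p : ℝ) + 1) ^ γ * a 0) := by rw [hc]; ring
      _ = K * L * (M p / M (p + 1)) := by
          rw [a0, mul_one, quot, div_eq_mul_inv, inv_div]
  exact ⟨summable_of_sum_range_le nonneg partial_le,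
    Real.tsum_le_of_sum_range_le nonneg partial_le⟩

theorem conclusion_of_doubling (hpos : ∀ p, 0 < M p) (hM0 : M 0 = 1) (hlc : LogConvex M) {w : ℝ}
    (hw : 0 < w)
    (h : Tendsto (fun p : ℕ => quot M (2 * p) / quot M p) atTop (𝓝 ((2 : ℝ) ^ w))) :
    StronglyRegular M ∧ (0 < growthIndex M ∧ growthIndex M < ⊤) ∧
    growthIndex M = omegaIndex M ∧
    Tendsto (fun p : ℕ => ((Real.log (quot M p) / Real.log p : ℝ) : EReal)) atTop
      (𝓝 (omegaIndex M)) := by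
  have hmono := quot_monotone hpos hlc
  have hq := quot_pos hpos
  have hlim := tendsto_log_div_log_of_doubling hq hmono hw h
  have hlim' : Tendsto (fun p : ℕ => ((Real.log (quot M p) / Real.log p : ℝ) : EReal)) atTop
      (𝓝 (w : EReal)) := (continuous_coe_real_ereal.tendsto w).comp hlim
  have homega : omegaIndex M = (w : EReal) := hlim'.liminf_eq
  have hai : ∀ γ : ℝ, 0 < γ → γ < w → ∃ K : ℝ, 0 < K ∧ ∀ p q : ℕ, p ≤ q →
      ((p : ℝ) + 1) ^ (-γ) * quot M p ≤ K * (((q : ℝ) + 1) ^ (-γ) * quot M q) :=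
    fun γ h0 h1 => almost_increasing_of_doubling hq hmono h0 (eventually_doubling_ge hq h1 h)
  have hgrowth : growthIndex M = (w : EReal) := by
    refine le_antisymm (sSup_le ?_) (le_of_forall_lt fun b hb => ?_)
    · rintro _ ⟨γ, hγ, hP, rfl⟩
      refine EReal.coe_le_coe_iff.2 (le_of_forall_lt fun a ha => ?_)
      obtain ⟨a', h1, h2⟩ := exists_between ha
      obtain ⟨K, hK, hK'⟩ := hP.almost_increasing
      obtain ⟨C, hC, hC'⟩ := exists_mul_rpow_le_of_almost_increasing hq hγ hK hK'
      exact h1.trans_le (ge_of_tendsto hlim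
        ((eventually_lt_log_div_log hC h2 hC').mono fun _ hp => hp.le))
    -- The bound `b` may be negative or `⊥`, while admissible `γ` must be positive.
    · have hb' : max b 0 < (w : EReal) := max_lt hb (EReal.coe_pos.2 hw)
      obtain ⟨γ, h1, h2⟩ := EReal.lt_iff_exists_real_btwn.1 hb'
      have h0 : 0 < γ := EReal.coe_pos.1 ((le_max_right _ _).trans_lt h1)
      obtain ⟨K, hK, hK'⟩ := hai γ h0 (EReal.coe_lt_coe_iff.1 h2)
      exact ((le_max_left _ _).trans_lt h1).trans_le
        (le_sSup ⟨γ, h0, propertyP_of_almost_increasing hK hK', rfl⟩)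
  refine ⟨⟨hlc, ?_, ?_⟩, ⟨?_, ?_⟩, hgrowth.trans homega.symm, homega ▸ hlim'⟩
  · obtain ⟨A, hA, hA'⟩ := exists_quot_le_of_doubling hpos hmono (by positivity)
      (eventually_doubling_le hq (lt_add_one w) h)
    exact moderateGrowth_of_quot_le hpos hM0 hmono hA hA'
  · obtain ⟨K, hK, hK'⟩ := hai (w / 2) (by positivity) (by linarith)
    exact strongNonQuasianalytic_of_almost_increasing hpos (by positivity) hK hK'
  · rw [hgrowth]
    exact EReal.coe_pos.2 hw
  · rw [hgrowth]
    exact EReal.coe_lt_top w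

end Regularity

/-! ### Condition (b): comparison with arithmetic means -/

section Means

/-- The Euler–Mascheroni constants cancel in the difference. -/
lemma tendsto_harmonic_two_mul_sub :
    Tendsto (fun p : ℕ => (harmonic (2 * p) : ℝ) - harmonic p) atTop (𝓝 (Real.log 2)) := by
  have h1 := Real.tendsto_harmonic_sub_log
  have h2 : Tendsto (fun p : ℕ => 2 * p) atTop atTop :=
    tendsto_id.const_mul_atTop' (by norm_num)
  have h3 := ((h1.comp h2).sub h1).add_const (Real.log 2)
  rw [sub_self, zero_add] at h3
  refine h3.congr' ?_
  filter_upwards [eventually_gt_atTop 0] with p hp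
  have hp' : (p : ℝ) ≠ 0 := by exact_mod_cast hp.ne'
  simp only [Function.comp_apply, Nat.cast_mul, Nat.cast_ofNat]
  rw [Real.log_mul (by norm_num) hp']
  ring

/-- If a sequence exceeds its arithmetic means `A` by `w + o(1)`, then its increments over dyadic
blocks tend to `w * log 2`. -/
lemma tendsto_dyadic_sub_of_tendsto_sub_mean {α A : ℕ → ℝ} {w : ℝ}
    (hA : ∀ p : ℕ, A (p + 1) - A p = (α p - A p) * ((p : ℝ) + 1)⁻¹)
    (h : Tendsto (fun p => α p - A p) atTop (𝓝 w)) :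
    Tendsto (fun p => α (2 * p) - α p) atTop (𝓝 (w * Real.log 2)) := by
  -- Removing the drift `w * harmonic p` leaves increments `o(1/p)`; the `p` of them from `p` to
  -- `2p` sum to `o(1)`.
  set β : ℕ → ℝ := fun p => A p - w * harmonic p with hβ
  have h2 : Tendsto (fun p : ℕ => 2 * p) atTop atTop :=
    tendsto_id.const_mul_atTop' (by norm_num)
  have step : ∀ p : ℕ, β (p + 1) - β p = (α p - A p - w) * ((p : ℝ) + 1)⁻¹ := by
    intro p
    simp only [hβ, harmonic_succ]
    push_cast
    linear_combination hA p
  have hβ0 : Tendsto (fun p => β (2 * p) - β p) atTop (𝓝 0) := by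
    rw [Metric.tendsto_atTop]
    intro ε hε
    obtain ⟨N, hN⟩ := Metric.tendsto_atTop.1 h (ε / 2) (by positivity)
    refine ⟨max N 1, fun p hp => ?_⟩
    have hp1 : 1 ≤ p := (le_max_right _ _).trans hp
    have hpN : N ≤ p := (le_max_left _ _).trans hp
    have hp0 : (0 : ℝ) < p := by exact_mod_cast hp1
    have bound : ∀ n : ℕ, |β (p + n) - β p| ≤ n * (ε / 2 * (p : ℝ)⁻¹) := by
      intro n
      induction n with
      | zero => simp
      | succ n ih =>
        have h3 := hN (p + n) (by omega)
        rw [Real.dist_eq] at h3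
        have h4 : |β (p + n + 1) - β (p + n)| ≤ ε / 2 * (p : ℝ)⁻¹ := by
          rw [step, abs_mul, abs_of_pos (a := (((p + n : ℕ) : ℝ) + 1)⁻¹) (by positivity)]
          refine mul_le_mul h3.le ?_ (by positivity) (by positivity)
          refine inv_anti₀ hp0 ?_
          push_cast
          have : (0 : ℝ) ≤ n := by positivity
          linarith
        have h5 := abs_sub_le (β (p + n + 1)) (β (p + n)) (β p)
        rw [← add_assoc]
        push_cast
        linarith
    have h3 := bound p
    rw [← two_mul] at h3
    rw [Real.dist_eq, sub_zero]
    have h4 : (p : ℝ) * (ε / 2 * (p : ℝ)⁻¹) = ε / 2 := by field_simp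
    linarith
  have h3 := ((hβ0.add (tendsto_harmonic_two_mul_sub.const_mul w)).add (h.comp h2)).sub h
  have e : 0 + w * Real.log 2 + w - w = w * Real.log 2 := by ring
  rw [e] at h3
  refine h3.congr fun p => ?_
  simp only [hβ, Function.comp_apply]
  ring

variable {M : ℕ → ℝ}

lemma log_quot_div_rpow (hpos : ∀ p, 0 < M p) (p : ℕ) :
    Real.log (quot M p / M p ^ (1 / (p : ℝ))) =
      Real.log (quot M p) - 1 / (p : ℝ) * Real.log (M p) := by
  rw [Real.log_div (quot_pos hpos p).ne' (Real.rpow_pos_of_pos (hpos p) _).ne',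
    Real.log_rpow (hpos p)]

lemma doubling_of_condB (hpos : ∀ p, 0 < M p) (hM0 : M 0 = 1) (h : CondB M) :
    ∃ w : ℝ, 0 < w ∧
      Tendsto (fun p : ℕ => quot M (2 * p) / quot M p) atTop (𝓝 ((2 : ℝ) ^ w)) := by
  obtain ⟨w, hw, h⟩ := h
  refine ⟨w, hw, ?_⟩
  simp only [log_quot_div_rpow hpos] at h
  have hA : ∀ p : ℕ, 1 / ((p + 1 : ℕ) : ℝ) * Real.log (M (p + 1)) - 1 / (p : ℝ) * Real.log (M p) =
      (Real.log (quot M p) - 1 / (p : ℝ) * Real.log (M p)) * ((p : ℝ) + 1)⁻¹ := by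
    intro p
    rcases Nat.eq_zero_or_pos p with rfl | hp
    -- At `p = 0` the convention `1 / 0 = 0` makes the empty mean `0`, and `M 0 = 1` keeps the
    -- recursion valid.
    · simp [quot, hM0]
    · have hp' : (p : ℝ) ≠ 0 := by exact_mod_cast hp.ne'
      have hp1 : (p : ℝ) + 1 ≠ 0 := by positivity
      rw [mul_quot hpos p, Real.log_mul (hpos p).ne' (quot_pos hpos p).ne']
      push_cast
      field_simp
      ring
  have h1 := (Real.continuous_exp.tendsto _).comp (tendsto_dyadic_sub_of_tendsto_sub_mean
    (α := fun p => Real.log (quot M p)) (A := fun p => 1 / (p : ℝ) * Real.log (M p)) hA h)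
  rw [mul_comm w, ← Real.rpow_def_of_pos (by norm_num)] at h1
  refine h1.congr fun p => ?_
  rw [Function.comp_apply, Real.exp_sub, Real.exp_log (quot_pos hpos _),
    Real.exp_log (quot_pos hpos _)]

end Means

/-! ### Condition (a): the associated function -/

section AssociatedFunction

variable {M : ℕ → ℝ}

/-- The increments in `k` are `log t - log (m k)`: nonnegative before `n`, nonpositive from `n` on.
-/
lemma log_pow_div_le (hpos : ∀ p, 0 < M p) {t : ℝ} (ht : 0 < t) {n : ℕ}
    (h1 : ∀ j < n, quot M j ≤ t) (h2 : ∀ j, n ≤ j → t ≤ quot M j) (k : ℕ) :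
    k * Real.log t - Real.log (M k) ≤ n * Real.log t - Real.log (M n) := by
  set g : ℕ → ℝ := fun k => k * Real.log t - Real.log (M k) with hg
  have step : ∀ k, g (k + 1) = g k + (Real.log t - Real.log (quot M k)) := by
    intro k
    simp only [hg]
    rw [mul_quot hpos k, Real.log_mul (hpos k).ne' (quot_pos hpos k).ne']
    push_cast
    ring
  change g k ≤ g n
  rcases le_total k n with hk | hk
  · have aux : ∀ j, k ≤ j → j ≤ n → g k ≤ g j := by
      intro j hj
      induction j, hj using Nat.le_induction with
      | base => intro _; exact le_rfl
      | succ j hj ih =>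
        intro hjn
        have := Real.log_le_log (quot_pos hpos j) (h1 j (by omega))
        rw [step]
        linarith [ih (by omega)]
    exact aux n hk le_rfl
  · induction k, hk using Nat.le_induction with
    | base => exact le_rfl
    | succ j hj ih =>
      have := Real.log_le_log ht (h2 j hj)
      rw [step]
      linarith

lemma assocFun_eq (hpos : ∀ p, 0 < M p) {t : ℝ} (ht : 0 < t) {n : ℕ}
    (h1 : ∀ j < n, quot M j ≤ t) (h2 : ∀ j, n ≤ j → t ≤ quot M j) :
    assocFun M t = n * Real.log t - Real.log (M n) := by
  have e : ∀ k : ℕ, Real.log (t ^ k / M k) = k * Real.log t - Real.log (M k) := fun k => by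
    rw [Real.log_div (by positivity) (hpos k).ne', Real.log_pow]
  rw [assocFun, if_pos ht]
  simp only [e]
  have hle := log_pow_div_le hpos ht h1 h2
  exact le_antisymm (ciSup_le hle) (le_ciSup (f := fun k : ℕ => k * Real.log t - Real.log (M k))
    ⟨_, Set.forall_mem_range.2 hle⟩ n)

lemma assocFun_pos (hpos : ∀ p, 0 < M p) {t : ℝ} (ht : 0 < t) (htM : M 1 < t) {n : ℕ}
    (h1 : ∀ j < n, quot M j ≤ t) (h2 : ∀ j, n ≤ j → t ≤ quot M j) : 0 < assocFun M t := by
  rw [assocFun_eq hpos ht h1 h2]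
  have h3 := log_pow_div_le hpos ht h1 h2 1
  have h4 := Real.log_lt_log (hpos 1) htM
  simp only [Nat.cast_one, one_mul] at h3
  linarith

/-- On `(x, y)` the associated function is affine in `log t` with slope `n`; differentiate `d_M(t)
log t = log M(t)`. -/
lemma hasDerivAt_dFun (hpos : ∀ p, 0 < M p) {x y t : ℝ} (hx : 0 ≤ x) (hxt : x < t) (hty : t < y)
    (ht1 : 1 < t) (htM : M 1 < t) {n : ℕ}
    (h1 : ∀ j < n, quot M j ≤ x) (h2 : ∀ j, n ≤ j → y ≤ quot M j) :
    DifferentiableAt ℝ (dFun M) t ∧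
      t * deriv (dFun M) t * Real.log t + dFun M t = n / assocFun M t := by
  have ht0 : 0 < t := by linarith
  have heq : ∀ s ∈ Set.Ioo x y, assocFun M s = n * Real.log s - Real.log (M n) := fun s hs =>
    assocFun_eq hpos (hx.trans_lt hs.1) (fun j hj => (h1 j hj).trans hs.1.le)
      (fun j hj => hs.2.le.trans (h2 j hj))
  have hG : 0 < assocFun M t := assocFun_pos hpos ht0 htM
    (fun j hj => (h1 j hj).trans hxt.le) (fun j hj => hty.le.trans (h2 j hj))
  have hlog : 0 < Real.log t := Real.log_pos ht1
  have hF : HasDerivAt (assocFun M) (n * t⁻¹) t := by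
    refine HasDerivAt.congr_of_eventuallyEq
      (((Real.hasDerivAt_log ht0.ne').const_mul (n : ℝ)).sub_const (Real.log (M n))) ?_
    filter_upwards [Ioo_mem_nhds hxt hty] with s hs using heq s hs
  have hd : HasDerivAt (dFun M) _ t :=
    (hF.log hG.ne').div (Real.hasDerivAt_log ht0.ne') hlog.ne'
  refine ⟨hd.differentiableAt, ?_⟩
  rw [hd.deriv, dFun]
  field_simp
  ring

/-- The estimate holds inside the interval and passes to an endpoint `e` by continuity with `n`
fixed, even if `d_M` is not differentiable at `e`. -/
lemma abs_div_assocFun_sub_le (hpos : ∀ p, 0 < M p) {l ε T : ℝ} (hT : 1 ≤ T) (hTM : M 1 ≤ T)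
    (H : ∀ t, T < t → DifferentiableAt ℝ (dFun M) t →
      |t * deriv (dFun M) t * Real.log t + dFun M t - l| ≤ ε)
    {x y e : ℝ} (hx : 0 ≤ x) (hxy : x < y) (he : e ∈ Set.Icc x y) (heT : T < e) {n : ℕ}
    (h1 : ∀ j < n, quot M j ≤ x) (h2 : ∀ j, n ≤ j → y ≤ quot M j) :
    |n / assocFun M e - l| ≤ ε := by
  have he0 : 0 < e := by linarith
  have heq : ∀ s ∈ Set.Icc x y, 0 < s → assocFun M s = n * Real.log s - Real.log (M n) :=
    fun s hs hs0 => assocFun_eq hpos hs0 (fun j hj => (h1 j hj).trans hs.1)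
      (fun j hj => hs.2.trans (h2 j hj))
  have hG : 0 < assocFun M e := assocFun_pos hpos he0 (by linarith)
    (fun j hj => (h1 j hj).trans he.1) (fun j hj => he.2.trans (h2 j hj))
  rw [heq e he he0] at hG ⊢
  have hcont : ContinuousAt (fun s : ℝ => |n / (n * Real.log s - Real.log (M n)) - l|) e := by
    refine ContinuousAt.abs (ContinuousAt.sub (ContinuousAt.div continuousAt_const ?_ hG.ne')
      continuousAt_const)
    exact (continuousAt_const.mul (Real.continuousAt_log he0.ne')).sub continuousAt_const
  have : (𝓝[Set.Ioo x y] e).NeBot := by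
    rw [← mem_closure_iff_nhdsWithin_neBot, closure_Ioo hxy.ne]
    exact he
  refine le_of_tendsto (hcont.tendsto.mono_left (nhdsWithin_le_nhds (s := Set.Ioo x y))) ?_
  filter_upwards [self_mem_nhdsWithin, nhdsWithin_le_nhds (Ioi_mem_nhds heT)] with t ht htT
  have htT' : T < t := htT
  obtain ⟨hd, hd'⟩ := hasDerivAt_dFun hpos hx ht.1 ht.2 (by linarith) (by linarith) h1 h2
  have := H t htT' hd
  rwa [hd', heq t ⟨ht.1.le, ht.2.le⟩ (by linarith)] at this

lemma condB_of_condA (hpos : ∀ p, 0 < M p) (hlc : LogConvex M)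
    (hm : Tendsto (quot M) atTop atTop) (h : CondA M) : CondB M := by
  obtain ⟨c, l, hl, hρ⟩ := h
  have hmono := quot_monotone hpos hlc
  have hassoc : ∀ p : ℕ, assocFun M (quot M p) = p * Real.log (quot M p) - Real.log (M p) :=
    fun p => assocFun_eq hpos (quot_pos hpos p) (fun j hj => hmono hj.le) (fun j hj => hmono hj)
  have hratio : Tendsto (fun p : ℕ => (p : ℝ) / assocFun M (quot M p)) atTop (𝓝 l) := by
    have hlim : Tendsto (fun t => t * deriv (dFun M) t * Real.log t + dFun M t)
        (atTop ⊓ 𝓟 {r : ℝ | DifferentiableAt ℝ (dFun M) r}) (𝓝 (0 + l)) :=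
      hρ.tendsto_deriv.add (hρ.tendsto.mono_left inf_le_left)
    rw [zero_add] at hlim
    rw [Metric.tendsto_nhds]
    intro ε hε
    have h1 := Metric.tendsto_nhds.1 hlim (ε / 2) (by positivity)
    rw [eventually_inf_principal] at h1
    obtain ⟨T₀, hT₀⟩ := eventually_atTop.1 h1
    set T := max T₀ (max 1 (M 1)) with hT
    have H : ∀ t, T < t → DifferentiableAt ℝ (dFun M) t →
        |t * deriv (dFun M) t * Real.log t + dFun M t - l| ≤ ε / 2 := fun t ht hd =>
      (hT₀ t ((le_max_left _ _).trans ht.le) hd).le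
    have hT1 : 1 ≤ T := (le_max_left _ _).trans (le_max_right _ _)
    have hTM : M 1 ≤ T := (le_max_right _ _).trans (le_max_right _ _)
    filter_upwards [hm.eventually_gt_atTop T, hm.eventually_gt_atTop (quot M 0)] with p hpT hp0
    have hG : 0 < assocFun M (quot M p) := assocFun_pos hpos (quot_pos hpos p)
      (by linarith) (fun j hj => hmono hj.le) (fun j hj => hmono hj)
    -- `a` and `b` are the ends of the block of indices on which the quotient is constant
    have exa : ∃ a, quot M p < quot M a := (hm.eventually_gt_atTop (quot M p)).exists
    have exb : ∃ b, quot M p ≤ quot M b := ⟨p, le_rfl⟩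
    classical
    obtain ⟨a, ha, ha'⟩ : ∃ a, quot M p < quot M a ∧ ∀ j < a, quot M j ≤ quot M p :=
      ⟨Nat.find exa, Nat.find_spec exa, fun j hj => not_lt.1 (Nat.find_min exa hj)⟩
    obtain ⟨b, hb, hb'⟩ : ∃ b, quot M p ≤ quot M b ∧ ∀ j < b, quot M j < quot M p :=
      ⟨Nat.find exb, Nat.find_spec exb, fun j hj => not_le.1 (Nat.find_min exb hj)⟩
    have hpa : p ≤ a := not_lt.1 fun hap => absurd (hmono hap.le) (not_le.2 ha)
    have hbp : b ≤ p := not_lt.1 fun hpb => lt_irrefl _ (hb' p hpb)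
    have hb1 : 1 ≤ b := Nat.one_le_iff_ne_zero.2 fun hb0 => by
      rw [hb0] at hb
      linarith
    -- Approaching `m p` from the right gives slope `a`, from the left slope `b`; `b ≤ p ≤ a` then
    -- squeezes `p / M(m p)`.
    have bound_a := abs_div_assocFun_sub_le hpos hT1 hTM H (quot_pos hpos p).le ha
      ⟨le_rfl, ha.le⟩ hpT ha' (fun j hj => hmono hj)
    have hblt := hb' (b - 1) (by omega)
    have bound_b := abs_div_assocFun_sub_le hpos hT1 hTM H (quot_pos hpos (b - 1)).le hblt
      ⟨hblt.le, le_rfl⟩ hpT (n := b) (fun j hj => hmono (by omega))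
      (fun j hj => hb.trans (hmono hj))
    have h3 : (p : ℝ) / assocFun M (quot M p) ≤ a / assocFun M (quot M p) :=
      div_le_div_of_nonneg_right (by exact_mod_cast hpa) hG.le
    have h4 : (b : ℝ) / assocFun M (quot M p) ≤ p / assocFun M (quot M p) :=
      div_le_div_of_nonneg_right (by exact_mod_cast hbp) hG.le
    rw [abs_le] at bound_a bound_b
    rw [Real.dist_eq, abs_lt]
    constructor <;> linarith [bound_a.2, bound_b.1]
  -- By `hassoc`, `M(m p) / p = log (m p) - (1/p) log (M p)`.
  refine ⟨l⁻¹, inv_pos.2 hl, (hratio.inv₀ hl.ne').congr' ?_⟩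
  filter_upwards [eventually_gt_atTop 0] with p hp
  have hp' : (p : ℝ) ≠ 0 := by exact_mod_cast hp.ne'
  rw [log_quot_div_rpow hpos, hassoc, inv_div]
  field_simp

end AssociatedFunction

/-! ### Conditions (c) and (d), and the theorem -/

lemma condD_of_condC {M : ℕ → ℝ} (h : CondC M) : CondD M := by
  obtain ⟨-, w, hw, h⟩ := h
  refine ⟨w, hw, fun l hl => ?_⟩
  have h1 := h l (by exact_mod_cast (by omega : 0 < l))
  simpa only [← Nat.cast_mul, Nat.floor_natCast] using h1

lemma doubling_of_condD {M : ℕ → ℝ} (h : CondD M) :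
    ∃ w : ℝ, 0 < w ∧
      Tendsto (fun p : ℕ => quot M (2 * p) / quot M p) atTop (𝓝 ((2 : ℝ) ^ w)) := by
  obtain ⟨w, hw, h⟩ := h
  exact ⟨w, hw, by exact_mod_cast h 2 le_rfl⟩

end WeightSeq

theorem corollary3p7 (M : ℕ → ℝ) (hpos : ∀ p : ℕ, 0 < M p) (hM0 : M 0 = 1)
    (hlc : WeightSeq.LogConvex M)
    (hm : Tendsto (WeightSeq.quot M) atTop atTop)
    (hcond : WeightSeq.CondA M ∨ WeightSeq.CondB M ∨ WeightSeq.CondC M ∨ WeightSeq.CondD M) :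
    WeightSeq.StronglyRegular M ∧
    (0 < WeightSeq.growthIndex M ∧ WeightSeq.growthIndex M < ⊤) ∧
    WeightSeq.growthIndex M = WeightSeq.omegaIndex M ∧
    Tendsto (fun p : ℕ => ((Real.log (WeightSeq.quot M p) / Real.log p : ℝ) : EReal)) atTop
      (𝓝 (WeightSeq.omegaIndex M)) := by
  obtain ⟨w, hw, h⟩ : ∃ w : ℝ, 0 < w ∧ Tendsto
      (fun p : ℕ => WeightSeq.quot M (2 * p) / WeightSeq.quot M p) atTop (𝓝 ((2 : ℝ) ^ w)) := by
    rcases hcond with hA | hB | hC | hD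
    · exact WeightSeq.doubling_of_condB hpos hM0 (WeightSeq.condB_of_condA hpos hlc hm hA)
    · exact WeightSeq.doubling_of_condB hpos hM0 hB
    · exact WeightSeq.doubling_of_condD (WeightSeq.condD_of_condC hC)
    · exact WeightSeq.doubling_of_condD hD
  exact WeightSeq.conclusion_of_doubling hpos hM0 hlc hw h
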